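/- Let $a_1,a_2,a_3\ge 1$ be integers and $n=a_1+a_2+a_3$. Let $\mathbb{Q}_{4n}=\langle \epsilon,j \mid \epsilon^{2n}=1,\ j^2=\epsilon^n,\ j^{-1}\epsilon j=\epsilon^{-1}\rangle$ be the generalized quaternion group of order $4n$. It acts on $\mathbb{R}^n$ by $\epsilon e_i=e_{i+1}$ (indices mod $n$), $je_i=e_{n-i+1}$, and hence on the hyperplane $W_n=\{x\in\mathbb{R}^n : x_1+\dots+x_n=0\}$. Put $$L(\alpha)=\Big\{x\in W_n : \sum_{i\le a_1}x_i=\sum_{a_1<i\le a_1+a_2}x_i=\sum_{a_1+a_2<i\le n}x_i=0\Big\}.$$ Let $\mathcal{J}$ be a finite collection of linear hyperplanes of $W_n$ and closed halves of such hyperplanes, let $U^*=\bigcup_{g\in\mathbb{Q}_{4n},\,J\in\mathcal{J}} g\,(J\cap L(\alpha))$ be the union of the smallest $\mathbb{Q}_{4n}$-invariant arrangement containing all $J\cap L(\alpha)$, and let $T^*=W_n\setminus U^*$; the group $H_2(T^*;\mathbb{Z})$ is a $\mathbb{Q}_{4n}$-module. Let $S^3$ be triangulated as the join $P_{2n}*P_{2n}$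 of two $2n$-gons with cyclically ordered vertices $a_1,\dots,a_{2n}$ and $b_1,\dots,b_{2n}$, with the free simplicial $\mathbb{Q}_{4n}$-action given by $\epsilon a_i=a_{i+1}$, $\epsilon b_i=b_{i+1}$, $ja_1=b_1$. Let $h:S^3\to W_n$ be a $\mathbb{Q}_{4n}$-equivariant map that is affine on every simplex and is in general position: for each simplex $\sigma$ with $h(\sigma)\cap U^*\ne\emptyset$, $h(\sigma)$ is $3$-dimensional and $h(\sigma)\cap U^*$ is a finite subset of the relative interior of $h(\sigma)$. Let $c_{\mathbb{Q}_{4n}}(h)\in \mathrm{Hom}_{\mathbb{Q}_{4n}}(C_3(S^3),H_2(T^*;\mathbb{Z}))$ be the obstruction cocycle, which sends an oriented $3$-simplex $\sigma$ to $h_*[\partial\sigma]$, where $[\partial\sigma]$ is the fundamental class of $\partial\sigma\cong S^2$ and $h_*:H_2(\partial\sigma;\mathbb{Z})\to H_2(T^*;\mathbb{Z})$. Then the cohomology class of $c_{\mathbb{Q}_{4n}}(h)$ is a torsion element of the equivariant cohomology group $H^3_{\mathbb{Q}_{4n}}(S^3,H_2(T^*;\mathbb{Z}))$, the third cohomology of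 the complex $\mathrm{Hom}_{\mathbb{Q}_{4n}}(C_*(S^3),H_2(T^*;\mathbb{Z}))$. -/

import Mathlib

noncomputable section
namespace FanObstruction
open CategoryTheory AlgebraicTopology
open scoped Simplicial

/-- Singular homology `H₂(X; ℤ)` of a topological space. -/
def H2 (X : Type) [TopologicalSpace X] : Type :=
  ((singularHomologyFunctor (ModuleCat.{0} ℤ) 2).obj (ModuleCat.of ℤ ℤ)).obj (TopCat.of X)

instance (X : Type) [TopologicalSpace X] : AddCommGroup (H2 X) :=
  inferInstanceAs (AddCommGroup
    (((singularHomologyFunctor (ModuleCat.{0} ℤ) 2).obj (ModuleCat.of ℤ ℤ)).obj (TopCat.of X)))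

/-- The homomorphism `f_* : H₂(X; ℤ) → H₂(Y; ℤ)` induced by a continuous map. -/
def H2.map {X Y : Type} [TopologicalSpace X] [TopologicalSpace Y] (f : C(X, Y)) :
    H2 X →+ H2 Y :=
  (((singularHomologyFunctor (ModuleCat.{0} ℤ) 2).obj (ModuleCat.of ℤ ℤ)).map
    (TopCat.ofHom f)).hom.toAddMonoidHom

theorem H2.map_id_apply {X : Type} [TopologicalSpace X] (z : H2 X) :
    H2.map (ContinuousMap.id X) z = z := by
  have h : TopCat.ofHom (ContinuousMap.id X) = 𝟙 (TopCat.of X) := rfl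
  unfold H2.map
  rw [h, CategoryTheory.Functor.map_id]
  rfl

theorem H2.map_comp_apply {X Y Z : Type} [TopologicalSpace X] [TopologicalSpace Y]
    [TopologicalSpace Z] (f : C(X, Y)) (g : C(Y, Z)) (z : H2 X) :
    H2.map (g.comp f) z = H2.map g (H2.map f z) := by
  have h : TopCat.ofHom (g.comp f) = TopCat.ofHom f ≫ TopCat.ofHom g := rfl
  unfold H2.map
  rw [h, CategoryTheory.Functor.map_comp]
  rfl

/-- A group acting continuously on `X` acts on `H₂(X; ℤ)` by functoriality. -/
instance (G X : Type) [Group G] [TopologicalSpace X] [MulAction G X] [ContinuousConstSMul G X] :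
    DistribMulAction G (H2 X) where
  smul g z := H2.map ⟨fun x => g • x, continuous_const_smul g⟩ z
  one_smul z := by
    have h : (⟨fun x => (1 : G) • x, continuous_const_smul 1⟩ : C(X, X)) =
        ContinuousMap.id X := by ext x; exact one_smul G x
    change H2.map _ z = z
    rw [h, H2.map_id_apply]
  mul_smul g g' z := by
    have h : (⟨fun x => (g * g') • x, continuous_const_smul (g * g')⟩ : C(X, X)) =
        (⟨fun x => g • x, continuous_const_smul g⟩ : C(X, X)).comp
          ⟨fun x => g' • x, continuous_const_smul g'⟩ := by ext x; exact mul_smul g g' x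
    change H2.map _ z = H2.map _ (H2.map _ z)
    rw [h, H2.map_comp_apply]
  smul_zero g := map_zero _
  smul_add g := map_add _

theorem H2.smul_def {G X : Type} [Group G] [TopologicalSpace X] [MulAction G X]
    [ContinuousConstSMul G X] (g : G) (z : H2 X) :
    g • z = H2.map ⟨fun x => g • x, continuous_const_smul g⟩ z := rfl

/-- The boundary `∂Δ³ ≅ S²` of the standard 3-simplex. -/
def BdTetra : Type := {x : stdSimplex ℝ (Fin 4) // ∃ i, x i = 0}

instance : TopologicalSpace BdTetra := instTopologicalSpaceSubtype

/-- The affine singular simplex `Δᵏ → ∂Δ³` with prescribed vertices among those of `Δ³`, not all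
of which occur. -/
def BdTetra.simplex {k : ℕ} (v : Fin (k + 1) → Fin 4) (hv : ∃ i, ∀ j, v j ≠ i) :
    C(stdSimplex ℝ (Fin (k + 1)), BdTetra) where
  toFun x := ⟨stdSimplex.map v x, by
    obtain ⟨i, hi⟩ := hv
    refine ⟨i, ?_⟩
    rw [stdSimplex.map_coe, FunOnFinite.linearMap_apply_apply]
    exact Finset.sum_eq_zero fun j hj => absurd (by simpa using hj) (hi j)⟩
  continuous_toFun := Continuous.subtype_mk (stdSimplex.continuous_map v) _

/-- The same, as a simplex of the singular simplicial set. -/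
def BdTetra.ssimplex {k : ℕ} (v : Fin (k + 1) → Fin 4) (hv : ∃ i, ∀ j, v j ≠ i) :
    (TopCat.toSSet.obj (TopCat.of BdTetra)) _⦋k⦌ :=
  (TopCat.toSSetObjEquiv (TopCat.of BdTetra) (.op ⦋k⦌)).symm (BdTetra.simplex v hv)

theorem BdTetra.δ_ssimplex {k : ℕ} (v : Fin (k + 2) → Fin 4) (hv : ∃ i, ∀ j, v j ≠ i)
    (i : Fin (k + 2)) :
    (TopCat.toSSet.obj (TopCat.of BdTetra)).δ i (BdTetra.ssimplex v hv) =
      BdTetra.ssimplex (v ∘ i.succAbove) (hv.imp fun _ h _ => h _) := by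
  apply (TopCat.toSSetObjEquiv (TopCat.of BdTetra) (.op ⦋k⦌)).injective
  unfold BdTetra.ssimplex
  rw [Equiv.apply_symm_apply]
  ext x : 1
  apply Subtype.ext
  change stdSimplex.map v (stdSimplex.map i.succAbove x) = stdSimplex.map (v ∘ i.succAbove) x
  rw [stdSimplex.map_comp_apply]

theorem exists_not_mem {m : ℕ} (hm : m < 4) (v : Fin m → Fin 4) : ∃ i, ∀ j, v j ≠ i := by
  by_contra! h
  have := Fintype.card_le_of_surjective v h
  simp only [Fintype.card_fin] at this
  omega

theorem comp_succAbove_zero (v : Fin 4 → Fin 4) :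
    v ∘ Fin.succAbove 0 = ![v 1, v 2, v 3] := by
  funext j; fin_cases j <;> rfl

theorem comp_succAbove_one (v : Fin 4 → Fin 4) :
    v ∘ Fin.succAbove 1 = ![v 0, v 2, v 3] := by
  funext j; fin_cases j <;> rfl

theorem comp_succAbove_two (v : Fin 4 → Fin 4) :
    v ∘ Fin.succAbove 2 = ![v 0, v 1, v 3] := by
  funext j; fin_cases j <;> rfl

theorem comp_succAbove_three (v : Fin 4 → Fin 4) :
    v ∘ Fin.succAbove 3 = ![v 0, v 1, v 2] := by
  funext j; fin_cases j <;> rfl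

/-- The singular chain complex of `∂Δ³`. -/
abbrev BdTetra.chains : ChainComplex (ModuleCat.{0} ℤ) ℕ :=
  ((singularChainComplexFunctor (ModuleCat.{0} ℤ)).obj (ModuleCat.of ℤ ℤ)).obj (TopCat.of BdTetra)

/-- The generator of the singular chains given by an affine singular simplex. -/
def BdTetra.gen {k : ℕ} (v : Fin (k + 1) → Fin 4) (hv : ∃ i, ∀ j, v j ≠ i) :
    ModuleCat.of ℤ ℤ ⟶ BdTetra.chains.X k :=
  SSet.ιChainComplex (X := TopCat.toSSet.obj (TopCat.of BdTetra)) (R := ModuleCat.of ℤ ℤ) (BdTetra.ssimplex v hv)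

theorem BdTetra.gen_d {k : ℕ} (v : Fin (k + 2) → Fin 4) (hv : ∃ i, ∀ j, v j ≠ i) :
    BdTetra.gen v hv ≫ BdTetra.chains.d (k + 1) k =
      ∑ i : Fin (k + 2), (-1 : ℤ) ^ (i : ℕ) •
        BdTetra.gen (v ∘ i.succAbove) (hv.imp fun _ h _ => h _) := by
  unfold BdTetra.gen
  refine (SSet.ιChainComplex_d (X := TopCat.toSSet.obj (TopCat.of BdTetra)) (R := ModuleCat.of ℤ ℤ) (BdTetra.ssimplex v hv)).trans ?_
  refine Finset.sum_congr rfl fun i _ => ?_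
  rw [BdTetra.δ_ssimplex]
  rfl

theorem BdTetra.gen_congr {k : ℕ} {v w : Fin (k + 1) → Fin 4} (hv : ∃ i, ∀ j, v j ≠ i)
    (h : v = w) : BdTetra.gen v hv = BdTetra.gen w (h ▸ hv) := by
  subst h
  rfl

theorem BdTetra.gen_d_two (v : Fin 3 → Fin 4) (hv : ∃ i, ∀ j, v j ≠ i) :
    BdTetra.gen (k := 2) v hv ≫ BdTetra.chains.d 2 1 =
      BdTetra.gen (k := 1) (v ∘ Fin.succAbove 0) (hv.imp fun _ h _ => h _) -
      BdTetra.gen (k := 1) (v ∘ Fin.succAbove 1) (hv.imp fun _ h _ => h _) +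
      BdTetra.gen (k := 1) (v ∘ Fin.succAbove 2) (hv.imp fun _ h _ => h _) := by
  refine (BdTetra.gen_d (k := 1) v hv).trans ?_
  refine (Fin.sum_univ_three _).trans ?_
  norm_num
  abel

theorem BdTetra.gen_d_three (v : Fin 4 → Fin 4) (hv : ∃ i, ∀ j, v j ≠ i) :
    BdTetra.gen (k := 3) v hv ≫ BdTetra.chains.d 3 2 =
      BdTetra.gen (k := 2) (v ∘ Fin.succAbove 0) (hv.imp fun _ h _ => h _) -
      BdTetra.gen (k := 2) (v ∘ Fin.succAbove 1) (hv.imp fun _ h _ => h _) +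
      BdTetra.gen (k := 2) (v ∘ Fin.succAbove 2) (hv.imp fun _ h _ => h _) -
      BdTetra.gen (k := 2) (v ∘ Fin.succAbove 3) (hv.imp fun _ h _ => h _) := by
  refine (BdTetra.gen_d (k := 2) v hv).trans ?_
  refine (Fin.sum_univ_four _).trans ?_
  norm_num
  abel

/-- The singular cycle `∑ᵢ (-1)ⁱ [v₀, …, v̂ᵢ, …, v₃]` in `∂Δ³`. -/
def BdTetra.cycle (v : Fin 4 → Fin 4) : ModuleCat.of ℤ ℤ ⟶ BdTetra.chains.X 2 :=
  ∑ i : Fin 4, (-1 : ℤ) ^ (i : ℕ) • BdTetra.gen (k := 2) (v ∘ i.succAbove) (exists_not_mem (by norm_num) _)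

theorem BdTetra.cycle_d (v : Fin 4 → Fin 4) :
    BdTetra.cycle v ≫ BdTetra.chains.d 2 1 = 0 := by
  unfold BdTetra.cycle
  rw [Preadditive.sum_comp]
  simp only [Preadditive.zsmul_comp, BdTetra.gen_d_two, Fin.sum_univ_four]
  have key : ∀ (i j : Fin 4) (p q : Fin 3) h,
      i.succAbove ∘ p.succAbove = j.succAbove ∘ q.succAbove →
      BdTetra.gen (k := 1) ((v ∘ i.succAbove) ∘ p.succAbove) h =
        BdTetra.gen (k := 1) ((v ∘ j.succAbove) ∘ q.succAbove)
          (exists_not_mem (m := 2) (by norm_num) _) := by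
    intro i j p q h e
    congr 1
    rw [Function.comp_assoc, e, Function.comp_assoc]
  rw [key 1 0 0 0 _ (by decide), key 2 0 0 1 _ (by decide), key 3 0 0 2 _ (by decide),
    key 2 1 1 1 _ (by decide), key 3 1 1 2 _ (by decide), key 3 2 2 2 _ (by decide)]
  norm_num
  abel

/-- The homology class of the cycle above. -/
def BdTetra.cycleClass (v : Fin 4 → Fin 4) : H2 BdTetra :=
  (HomologicalComplex.liftCycles BdTetra.chains (BdTetra.cycle v) 1 (by simp)
    (BdTetra.cycle_d v) ≫ HomologicalComplex.homologyπ BdTetra.chains 2).hom (1 : ℤ)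

/-- The fundamental class of `∂Δ³ ≅ S²` for the orientation given by the order of vertices:
the class of the cycle `∑ᵢ (-1)ⁱ [0, …, î, …, 3]`. -/
def BdTetra.fundamentalClass : H2 BdTetra := BdTetra.cycleClass id

/-- The self-map of `∂Δ³` induced by a permutation of the vertices. -/
def BdTetra.permMap (π : Equiv.Perm (Fin 4)) : C(BdTetra, BdTetra) where
  toFun x := ⟨stdSimplex.map π x.1, by
    obtain ⟨i, hi⟩ := x.2
    refine ⟨π i, ?_⟩
    rw [stdSimplex.map_coe, FunOnFinite.linearMap_apply_apply]
    refine Finset.sum_eq_zero fun j hj => ?_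
    have : j = i := π.injective (by simpa using hj)
    rw [this, hi]⟩
  continuous_toFun :=
    Continuous.subtype_mk ((stdSimplex.continuous_map π).comp continuous_subtype_val) _

theorem BdTetra.cycle_comp (π : Equiv.Perm (Fin 4)) (v : Fin 4 → Fin 4) :
    BdTetra.cycle v ≫ (((singularChainComplexFunctor (ModuleCat.{0} ℤ)).obj
      (ModuleCat.of ℤ ℤ)).map (TopCat.ofHom (BdTetra.permMap π))).f 2 =
      BdTetra.cycle (π ∘ v) := by
  unfold BdTetra.cycle
  rw [Preadditive.sum_comp]
  refine Finset.sum_congr rfl fun i _ => ?_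
  rw [Preadditive.zsmul_comp]
  congr 1
  unfold BdTetra.gen
  refine (SSet.ι_chainComplexMap_f (X := TopCat.toSSet.obj (TopCat.of BdTetra))
    (Y := TopCat.toSSet.obj (TopCat.of BdTetra)) (f := TopCat.toSSet.map
      (TopCat.ofHom (BdTetra.permMap π))) (R := ModuleCat.of ℤ ℤ) _).trans ?_
  congr 1
  apply (TopCat.toSSetObjEquiv (TopCat.of BdTetra) (.op ⦋2⦌)).injective
  unfold BdTetra.ssimplex
  rw [Equiv.apply_symm_apply]
  ext x : 1
  apply Subtype.ext
  change stdSimplex.map π (stdSimplex.map (v ∘ i.succAbove) x) =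
    stdSimplex.map ((π ∘ v) ∘ i.succAbove) x
  rw [stdSimplex.map_comp_apply]
  rfl

theorem BdTetra.map_permMap_cycleClass (π : Equiv.Perm (Fin 4)) (v : Fin 4 → Fin 4) :
    H2.map (BdTetra.permMap π) (BdTetra.cycleClass v) = BdTetra.cycleClass (π ∘ v) := by
  let φ := ((singularChainComplexFunctor (ModuleCat.{0} ℤ)).obj
      (ModuleCat.of ℤ ℤ)).map (TopCat.ofHom (BdTetra.permMap π))
  have h : (HomologicalComplex.liftCycles BdTetra.chains (BdTetra.cycle v) 1 (by simp)
    (BdTetra.cycle_d v) ≫ HomologicalComplex.homologyπ BdTetra.chains 2) ≫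
      HomologicalComplex.homologyMap φ 2 =
      HomologicalComplex.liftCycles BdTetra.chains (BdTetra.cycle (π ∘ v)) 1 (by simp)
    (BdTetra.cycle_d _) ≫ HomologicalComplex.homologyπ BdTetra.chains 2 := by
    rw [Category.assoc, HomologicalComplex.homologyπ_naturality, ← Category.assoc]
    congr 1
    rw [← cancel_mono (HomologicalComplex.iCycles _ _)]
    simp only [Category.assoc, HomologicalComplex.cyclesMap_i,
      HomologicalComplex.liftCycles_i, HomologicalComplex.liftCycles_i_assoc]
    exact BdTetra.cycle_comp π v
  exact congrArg (fun f => f.hom (1 : ℤ)) h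

theorem BdTetra.cycleClass_add_eq_zero (v w : Fin 4 → Fin 4)
    (c : ModuleCat.of ℤ ℤ ⟶ BdTetra.chains.X 3)
    (h : BdTetra.cycle v + BdTetra.cycle w = c ≫ BdTetra.chains.d 3 2) :
    BdTetra.cycleClass v + BdTetra.cycleClass w = 0 := by
  have h0 := HomologicalComplex.liftCycles_homologyπ_eq_zero_of_boundary BdTetra.chains
    (BdTetra.cycle v + BdTetra.cycle w) 1 (by simp) c h
  have h1 : HomologicalComplex.liftCycles BdTetra.chains (BdTetra.cycle v + BdTetra.cycle w) 1
      (by simp) (by rw [h, Category.assoc, HomologicalComplex.d_comp_d, Limits.comp_zero]) =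
      HomologicalComplex.liftCycles BdTetra.chains (BdTetra.cycle v) 1 (by simp)
        (BdTetra.cycle_d v) +
      HomologicalComplex.liftCycles BdTetra.chains (BdTetra.cycle w) 1 (by simp)
        (BdTetra.cycle_d w) := by
    rw [← cancel_mono (HomologicalComplex.iCycles _ _)]
    simp
  rw [h1, Preadditive.add_comp] at h0
  exact congrArg (fun f => f.hom (1 : ℤ)) h0

theorem BdTetra.cycle_eq (v : Fin 4 → Fin 4) :
    BdTetra.cycle v = BdTetra.gen (k := 2) ![v 1, v 2, v 3] (exists_not_mem (by norm_num) _) -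
      BdTetra.gen (k := 2) ![v 0, v 2, v 3] (exists_not_mem (by norm_num) _) +
      BdTetra.gen (k := 2) ![v 0, v 1, v 3] (exists_not_mem (by norm_num) _) -
      BdTetra.gen (k := 2) ![v 0, v 1, v 2] (exists_not_mem (by norm_num) _) := by
  unfold BdTetra.cycle
  rw [Fin.sum_univ_four]
  rw [BdTetra.gen_congr _ (comp_succAbove_zero v), BdTetra.gen_congr _ (comp_succAbove_one v),
    BdTetra.gen_congr _ (comp_succAbove_two v), BdTetra.gen_congr _ (comp_succAbove_three v)]
  norm_num
  abel

theorem BdTetra.gen_d_three' (v : Fin 4 → Fin 4) (hv : ∃ i, ∀ j, v j ≠ i) :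
    BdTetra.gen (k := 3) v hv ≫ BdTetra.chains.d 3 2 =
      BdTetra.gen (k := 2) ![v 1, v 2, v 3] (exists_not_mem (by norm_num) _) -
      BdTetra.gen (k := 2) ![v 0, v 2, v 3] (exists_not_mem (by norm_num) _) +
      BdTetra.gen (k := 2) ![v 0, v 1, v 3] (exists_not_mem (by norm_num) _) -
      BdTetra.gen (k := 2) ![v 0, v 1, v 2] (exists_not_mem (by norm_num) _) := by
  rw [BdTetra.gen_d_three]
  rw [BdTetra.gen_congr _ (comp_succAbove_zero v), BdTetra.gen_congr _ (comp_succAbove_one v),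
    BdTetra.gen_congr _ (comp_succAbove_two v), BdTetra.gen_congr _ (comp_succAbove_three v)]

theorem BdTetra.cycleClass_swap (i : Fin 3) :
    BdTetra.cycleClass (Equiv.swap i.castSucc i.succ) = - BdTetra.cycleClass id := by
  rw [eq_neg_iff_add_eq_zero]
  fin_cases i
  · refine BdTetra.cycleClass_add_eq_zero _ _
      (BdTetra.gen (k := 3) ![0, 0, 2, 3] (by decide) +
        BdTetra.gen (k := 3) ![0, 1, 0, 3] (by decide) -
        BdTetra.gen (k := 3) ![0, 1, 0, 2] (by decide)) ?_
    have e : (⇑(Equiv.swap (Fin.castSucc (0 : Fin 3)) (Fin.succ (0 : Fin 3))) : Fin 4 → Fin 4) =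
      ![1, 0, 2, 3] := by decide
    change BdTetra.cycle (⇑(Equiv.swap (Fin.castSucc (0 : Fin 3)) (Fin.succ (0 : Fin 3)))) + _ = _
    rw [e]
    simp only [BdTetra.cycle_eq, Preadditive.add_comp, Preadditive.sub_comp, BdTetra.gen_d_three',
      Matrix.cons_val, id]
    abel
  · refine BdTetra.cycleClass_add_eq_zero _ _
      (BdTetra.gen (k := 3) ![1, 2, 1, 3] (by decide) +
        BdTetra.gen (k := 3) ![0, 1, 1, 3] (by decide) +
        BdTetra.gen (k := 3) ![0, 1, 2, 1] (by decide)) ?_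
    have e : (⇑(Equiv.swap (Fin.castSucc (1 : Fin 3)) (Fin.succ (1 : Fin 3))) : Fin 4 → Fin 4) =
      ![0, 2, 1, 3] := by decide
    change BdTetra.cycle (⇑(Equiv.swap (Fin.castSucc (1 : Fin 3)) (Fin.succ (1 : Fin 3)))) + _ = _
    rw [e]
    simp only [BdTetra.cycle_eq, Preadditive.add_comp, BdTetra.gen_d_three',
      Matrix.cons_val, id]
    abel
  · refine BdTetra.cycleClass_add_eq_zero _ _
      (BdTetra.gen (k := 3) ![0, 2, 3, 2] (by decide) +
        BdTetra.gen (k := 3) ![0, 1, 2, 2] (by decide) -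
        BdTetra.gen (k := 3) ![1, 2, 3, 2] (by decide)) ?_
    have e : (⇑(Equiv.swap (Fin.castSucc (2 : Fin 3)) (Fin.succ (2 : Fin 3))) : Fin 4 → Fin 4) =
      ![0, 1, 3, 2] := by decide
    change BdTetra.cycle (⇑(Equiv.swap (Fin.castSucc (2 : Fin 3)) (Fin.succ (2 : Fin 3)))) + _ = _
    rw [e]
    simp only [BdTetra.cycle_eq, Preadditive.add_comp, Preadditive.sub_comp, BdTetra.gen_d_three',
      Matrix.cons_val, id]
    abel

/-- An odd permutation of the vertices reverses the fundamental class, an even one fixes it. -/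
theorem BdTetra.map_permMap_fundamentalClass (π : Equiv.Perm (Fin 4)) :
    H2.map (BdTetra.permMap π) BdTetra.fundamentalClass =
      (Equiv.Perm.sign π : ℤ) • BdTetra.fundamentalClass := by
  have hcomp : ∀ π ρ : Equiv.Perm (Fin 4), H2.map (BdTetra.permMap (π * ρ))
      BdTetra.fundamentalClass = H2.map (BdTetra.permMap π) (H2.map (BdTetra.permMap ρ)
        BdTetra.fundamentalClass) := by
    intro π ρ
    simp only [BdTetra.fundamentalClass, BdTetra.map_permMap_cycleClass]
    rfl
  have hmem : π ∈ Submonoid.closure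
      (Set.range fun i : Fin 3 ↦ Equiv.swap i.castSucc i.succ) := by
    rw [Equiv.Perm.mclosure_swap_castSucc_succ]; trivial
  induction hmem using Submonoid.closure_induction with
  | mem x hx =>
    obtain ⟨i, rfl⟩ := hx
    have hne : i.castSucc ≠ i.succ := i.castSucc_lt_succ.ne
    rw [Equiv.Perm.sign_swap hne, BdTetra.fundamentalClass, BdTetra.map_permMap_cycleClass,
      Function.comp_id, BdTetra.cycleClass_swap]
    simp
  | one =>
    rw [BdTetra.fundamentalClass, BdTetra.map_permMap_cycleClass]
    simp
  | mul x y _ _ hx hy =>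
    rw [hcomp, hy, map_zsmul, hx, Equiv.Perm.sign_mul, smul_smul, Units.val_mul, mul_comm]

/-! ### Equivariant simplicial cochains -/

/-- An oriented `k`-simplex of `K`, given by an ordering of its `k + 1` distinct vertices. -/
structure OrientedSimplex {V : Type} [DecidableEq V] (K : AbstractSimplicialComplex V)
    (k : ℕ) where
  vertex : Fin (k + 1) → V
  injective : Function.Injective vertex
  mem : Finset.univ.image vertex ∈ K

/-- The same simplex with its vertices reordered by `π`. -/
def OrientedSimplex.reorder {V : Type} [DecidableEq V] {K : AbstractSimplicialComplex V}
    {k : ℕ} (σ : OrientedSimplex K k) (π : Equiv.Perm (Fin (k + 1))) : OrientedSimplex K k where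
  vertex := σ.vertex ∘ π
  injective := σ.injective.comp π.injective
  mem := by
    have h : Finset.univ.image (σ.vertex ∘ π) = Finset.univ.image σ.vertex := by
      rw [← Finset.image_image, Finset.image_univ_equiv]
    rw [h]
    exact σ.mem

/-- The face of an oriented simplex obtained by deleting the `i`-th vertex. -/
def OrientedSimplex.face {V : Type} [DecidableEq V] {K : AbstractSimplicialComplex V}
    {k : ℕ} (σ : OrientedSimplex K (k + 1)) (i : Fin (k + 2)) : OrientedSimplex K k where
  vertex := σ.vertex ∘ i.succAbove
  injective := σ.injective.comp Fin.succAbove_right_injective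
  mem := by
    refine (K.isRelLowerSet_faces σ.mem).2 ?_ (Finset.univ_nonempty.image _)
    rw [← Finset.image_image]
    exact Finset.image_subset_image (Finset.subset_univ _)

theorem OrientedSimplex.ext {V : Type} [DecidableEq V] {K : AbstractSimplicialComplex V}
    {k : ℕ} {σ τ : OrientedSimplex K k} (h : σ.vertex = τ.vertex) : σ = τ := by
  cases σ; cases τ; cases h; rfl

/-- The group `C^k_G(K; M) = Hom_G(C_k(K), M)` of equivariant cochains: `C_k(K)` is the free abelian
group on the oriented `k`-simplices modulo `σ ∘ π = sign(π) σ`, so such a cochain is an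
alternating, `G`-equivariant function on oriented simplices. -/
def EquivariantCochain (G : Type) [Group G] {V : Type} [DecidableEq V] [MulAction G V]
    (K : AbstractSimplicialComplex V) (M : Type) [AddCommGroup M] [DistribMulAction G M] (k : ℕ) :
    AddSubgroup (OrientedSimplex K k → M) where
  carrier := {f | (∀ σ π, f (σ.reorder π) = (Equiv.Perm.sign π : ℤ) • f σ) ∧
    ∀ (g : G) (σ τ : OrientedSimplex K k), (∀ i, τ.vertex i = g • σ.vertex i) → f τ = g • f σ}
  zero_mem' := ⟨fun _ _ => by simp, fun _ _ _ _ => by simp⟩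
  add_mem' := by
    rintro f f' ⟨h1, h2⟩ ⟨h1', h2'⟩
    exact ⟨fun σ π => by simp [h1, h1'], fun g σ τ h => by simp [h2 g σ τ h, h2' g σ τ h]⟩
  neg_mem' := by
    rintro f ⟨h1, h2⟩
    exact ⟨fun σ π => by simp [h1], fun g σ τ h => by simp [h2 g σ τ h]⟩

theorem exists_perm_succAbove {k : ℕ} (π : Equiv.Perm (Fin (k + 1))) (i : Fin (k + 1)) :
    ∃ ρ : Equiv.Perm (Fin k), (∀ j, π (i.succAbove j) = (π i).succAbove (ρ j)) ∧
      (Equiv.Perm.sign ρ : ℤ) = (-1) ^ (i : ℕ) * (-1) ^ (π i : ℕ) * Equiv.Perm.sign π := by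
  obtain ⟨⟨p, ρ⟩, hρ⟩ := Equiv.Perm.decomposeFin.symm.surjective
    ((π i).cycleRange * π * i.cycleRange⁻¹)
  have happ : ∀ x, Equiv.Perm.decomposeFin.symm (p, ρ) x =
      (π i).cycleRange (π (i.cycleRange.symm x)) := fun x => by rw [hρ]; rfl
  have hp : p = 0 := by
    have := happ 0
    rw [Equiv.Perm.decomposeFin_symm_apply_zero, Fin.cycleRange_symm_zero] at this
    rw [this, Fin.cycleRange_self]
  subst hp
  refine ⟨ρ, fun j => ?_, ?_⟩
  · have := happ j.succ
    rw [Equiv.Perm.decomposeFin_symm_apply_succ, Fin.cycleRange_symm_succ, Equiv.swap_self,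
      Equiv.refl_apply] at this
    rw [← Fin.cycleRange_symm_succ (π i), this, Equiv.symm_apply_apply]
  · have := congrArg Equiv.Perm.sign hρ
    rw [Equiv.Perm.decomposeFin.symm_sign, if_pos rfl, one_mul] at this
    rw [this]
    simp only [Equiv.Perm.sign_mul, Equiv.Perm.sign_inv, Fin.sign_cycleRange, Units.val_mul,
      Units.val_pow_eq_pow_val, Units.val_neg, Units.val_one]
    ring

/-- The coboundary `(δf)(σ) = ∑ᵢ (-1)ⁱ f([v₀, …, v̂ᵢ, …])`. -/
def coboundary (G : Type) [Group G] {V : Type} [DecidableEq V] [MulAction G V]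
    (K : AbstractSimplicialComplex V) (M : Type) [AddCommGroup M] [DistribMulAction G M] (k : ℕ) :
    EquivariantCochain G K M k →+ EquivariantCochain G K M (k + 1) where
  toFun f := ⟨fun σ => ∑ i : Fin (k + 2), (-1 : ℤ) ^ (i : ℕ) • f.1 (σ.face i), by
    refine ⟨fun σ π => ?_, fun g σ τ h => ?_⟩
    · rw [Finset.smul_sum, ← Equiv.sum_comp π]
      refine Finset.sum_congr rfl fun i _ => ?_
      obtain ⟨ρ, hρ, hs⟩ := exists_perm_succAbove π i
      have hface : (σ.reorder π).face i = (σ.face (π i)).reorder ρ :=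
        OrientedSimplex.ext (funext fun j => congrArg σ.vertex (hρ j))
      rw [hface, f.2.1, hs, smul_smul, smul_smul]
      congr 1
      have h1 : ((-1 : ℤ) ^ (i : ℕ)) * (-1) ^ (i : ℕ) = 1 := by
        rw [← mul_pow]; simp
      linear_combination ((-1 : ℤ) ^ (π i : ℕ) * (Equiv.Perm.sign π : ℤ)) * h1
    · rw [Finset.smul_sum]
      refine Finset.sum_congr rfl fun i _ => ?_
      rw [f.2.2 g (σ.face i) (τ.face i) (fun j => h _), smul_comm]⟩
  map_zero' := by ext; simp
  map_add' f f' := by ext; simp [Finset.sum_add_distrib]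

/-- The equivariant cohomology group `H^{k+1}_G(K; M)`, cocycles modulo coboundaries. -/
abbrev EquivariantCohomology (G : Type) [Group G] {V : Type} [DecidableEq V] [MulAction G V]
    (K : AbstractSimplicialComplex V) (M : Type) [AddCommGroup M] [DistribMulAction G M]
    (k : ℕ) : Type :=
  (coboundary G K M (k + 1)).ker ⧸
    (coboundary G K M k).range.addSubgroupOf (coboundary G K M (k + 1)).ker

/-! ### The sphere `S³ = P₂ₙ * P₂ₙ` -/

/-- The vertices of the join of two `2n`-gons: `inl i` is `a_{i+1}` and `inr i` is `b_{i+1}`. -/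
def JoinVertex (n : ℕ) : Type := ZMod (2 * n) ⊕ ZMod (2 * n)

instance (n : ℕ) : DecidableEq (JoinVertex n) :=
  inferInstanceAs (DecidableEq (ZMod (2 * n) ⊕ ZMod (2 * n)))

instance (n : ℕ) [NeZero n] : Fintype (JoinVertex n) :=
  inferInstanceAs (Fintype (ZMod (2 * n) ⊕ ZMod (2 * n)))

/-- The vertex `a_{i+1}` of the first polygon. -/
def JoinVertex.a {n : ℕ} (i : ZMod (2 * n)) : JoinVertex n := Sum.inl i

/-- The vertex `b_{i+1}` of the second polygon. -/
def JoinVertex.b {n : ℕ} (i : ZMod (2 * n)) : JoinVertex n := Sum.inr i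

theorem two_mul_cast_self (n : ℕ) : (n : ZMod (2 * n)) + n = 0 := by
  have : ((2 * n : ℕ) : ZMod (2 * n)) = 0 := ZMod.natCast_self _
  rw [← this]; push_cast; ring

/-- With `ε = QuaternionGroup.a 1` and `j = QuaternionGroup.xa 0`, so that `xa k = j εᵏ`, the action
of `Q₄ₙ` on the vertices with `ε aᵢ = aᵢ₊₁`, `ε bᵢ = bᵢ₊₁` and `j a₁ = b₁`. -/
instance (n : ℕ) : MulAction (QuaternionGroup n) (JoinVertex n) where
  smul g v := match g, v with
    | .a k, .inl i => .a (i + k)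
    | .a k, .inr i => .b (i + k)
    | .xa k, .inl i => .b (-(i + k))
    | .xa k, .inr i => .a (n - (i + k))
  one_smul v := by
    rcases v with i | i
    · exact congrArg JoinVertex.a (add_zero i)
    · exact congrArg JoinVertex.b (add_zero i)
  mul_smul g g' v := by
    have h2 := two_mul_cast_self n
    rcases g with k | k <;> rcases g' with k' | k' <;> rcases v with i | i
    · exact congrArg JoinVertex.a (by ring)
    · exact congrArg JoinVertex.b (by ring)
    · exact congrArg JoinVertex.b (by ring)
    · exact congrArg JoinVertex.a (by ring)
    · exact congrArg JoinVertex.b (by ring)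
    · exact congrArg JoinVertex.a (by ring)
    · exact congrArg JoinVertex.a (by ring)
    · exact congrArg JoinVertex.b (by linear_combination h2)

/-- The simplicial complex `P₂ₙ * P₂ₙ`: its simplices are the nonempty subsets of the sets
`{aᵢ, aᵢ₊₁, bₖ, bₖ₊₁}`. -/
def joinComplex (n : ℕ) : AbstractSimplicialComplex (JoinVertex n) where
  faces := {s | s.Nonempty ∧ ∃ i k : ZMod (2 * n),
    s ⊆ {JoinVertex.a i, JoinVertex.a (i + 1), JoinVertex.b k, JoinVertex.b (k + 1)}}
  isRelLowerSet_faces := by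
    rintro s ⟨hs, i, k, h⟩
    exact ⟨hs, fun t hts ht => ⟨ht, i, k, hts.trans h⟩⟩
  singleton_mem := by
    rintro (i | i)
    · exact ⟨Finset.singleton_nonempty _, i, i,
        Finset.singleton_subset_iff.2 (Finset.mem_insert_self _ _)⟩
    · exact ⟨Finset.singleton_nonempty _, i, i, Finset.singleton_subset_iff.2
        (Finset.mem_insert_of_mem (Finset.mem_insert_of_mem (Finset.mem_insert_self _ _)))⟩

theorem joinComplex_image_smul {n : ℕ} (g : QuaternionGroup n) {s : Finset (JoinVertex n)}
    (hs : s ∈ joinComplex n) : s.image (g • ·) ∈ joinComplex n := by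
  obtain ⟨hne, i, k, h⟩ := hs
  refine ⟨hne.image _, ?_⟩
  rcases g with m | m
  · refine ⟨i + m, k + m, (Finset.image_subset_image h).trans ?_⟩
    intro x hx
    simp only [Finset.mem_image, Finset.mem_insert, Finset.mem_singleton] at hx ⊢
    obtain ⟨y, rfl | rfl | rfl | rfl, rfl⟩ := hx
    · left; rfl
    · right; left; exact congrArg JoinVertex.a (by ring)
    · right; right; left; rfl
    · right; right; right; exact congrArg JoinVertex.b (by ring)
  · refine ⟨n - (k + 1 + m), -(i + 1 + m), (Finset.image_subset_image h).trans ?_⟩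
    intro x hx
    simp only [Finset.mem_image, Finset.mem_insert, Finset.mem_singleton] at hx ⊢
    obtain ⟨y, rfl | rfl | rfl | rfl, rfl⟩ := hx
    · right; right; right; exact congrArg JoinVertex.b (by ring)
    · right; right; left; rfl
    · right; left; exact congrArg JoinVertex.a (by ring)
    · left; rfl

/-- The geometric realization of `P₂ₙ * P₂ₙ` in barycentric coordinates, homeomorphic to `S³`. -/
def JoinSphere (n : ℕ) [NeZero n] : Type :=
  {x : stdSimplex ℝ (JoinVertex n) // ∃ s ∈ joinComplex n, ∀ v, x v ≠ 0 → v ∈ s}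

instance (n : ℕ) [NeZero n] : TopologicalSpace (JoinSphere n) := instTopologicalSpaceSubtype

theorem map_support {X Y : Type} [Fintype X] [Fintype Y] (f : X → Y) (x : stdSimplex ℝ X)
    (y : Y) (h : stdSimplex.map f x y ≠ 0) : ∃ v, x v ≠ 0 ∧ f v = y := by
  classical
  rw [stdSimplex.map_coe, FunOnFinite.linearMap_apply_apply] at h
  obtain ⟨v, hv, hne⟩ := Finset.exists_ne_zero_of_sum_ne_zero h
  exact ⟨v, hne, by simpa using hv⟩

/-- The simplicial action of `Q₄ₙ` on the realization. -/
instance (n : ℕ) [NeZero n] : MulAction (QuaternionGroup n) (JoinSphere n) where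
  smul g x := ⟨stdSimplex.map (g • ·) x.1, by
    obtain ⟨s, hs, h⟩ := x.2
    refine ⟨s.image (g • ·), joinComplex_image_smul g hs, fun v hv => ?_⟩
    obtain ⟨w, hw, rfl⟩ := map_support _ _ _ hv
    exact Finset.mem_image_of_mem _ (h w hw)⟩
  one_smul x := by
    apply Subtype.ext
    change stdSimplex.map (fun v => (1 : QuaternionGroup n) • v) x.1 = x.1
    have : (fun v : JoinVertex n => (1 : QuaternionGroup n) • v) = id := funext fun v => one_smul _ v
    rw [this, stdSimplex.map_id_apply]
  mul_smul g g' x := by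
    apply Subtype.ext
    change stdSimplex.map (fun v => (g * g') • v) x.1 =
      stdSimplex.map (g • ·) (stdSimplex.map (g' • ·) x.1)
    rw [stdSimplex.map_comp_apply]
    congr 1
    exact funext fun v => mul_smul g g' v

/-- A vertex of the complex as a point of the realization. -/
def JoinSphere.vertex {n : ℕ} [NeZero n] (v : JoinVertex n) : JoinSphere n :=
  ⟨stdSimplex.vertex v, {v}, (joinComplex n).singleton_mem v, fun w hw => by
    by_contra hne
    exact hw (by simp [stdSimplex.vertex_coe, Finset.mem_singleton.not.1 hne])⟩

/-- The closed geometric simplex spanned by `s`. -/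
def JoinSphere.closedSimplex {n : ℕ} [NeZero n] (s : Finset (JoinVertex n)) :
    Set (JoinSphere n) :=
  {x | ∀ v, x.1 v ≠ 0 → v ∈ s}

/-- The parametrization `∂Δ³ → ∂σ ⊆ S³` of the boundary of an oriented 3-simplex. -/
def JoinSphere.boundaryMap {n : ℕ} [NeZero n] (σ : OrientedSimplex (joinComplex n) 3) :
    C(BdTetra, JoinSphere n) where
  toFun x := ⟨stdSimplex.map σ.vertex x.1, Finset.univ.image σ.vertex, σ.mem, fun v hv => by
    obtain ⟨i, -, rfl⟩ := map_support _ _ _ hv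
    exact Finset.mem_image_of_mem _ (Finset.mem_univ i)⟩
  continuous_toFun :=
    Continuous.subtype_mk ((stdSimplex.continuous_map _).comp continuous_subtype_val) _

/-! ### The target `W_n` and the arrangement -/

/-- The hyperplane `W_n = {x ∈ ℝⁿ | x₁ + ⋯ + xₙ = 0}`. The coordinate with index `i : ZMod n`
is `x_{i+1}`. -/
abbrev W (n : ℕ) [NeZero n] : Type :=
  LinearMap.ker (∑ i : ZMod n, LinearMap.proj i : (ZMod n → ℝ) →ₗ[ℝ] ℝ)

/-- The action of `Q₄ₙ` on the indices of the standard basis, with `ε eᵢ = eᵢ₊₁` and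
`j eᵢ = eₙ₋ᵢ₊₁`. -/
instance (n : ℕ) : MulAction (QuaternionGroup n) (ZMod n) where
  smul g i := match g with
    | .a k => i + ZMod.castHom (Dvd.intro_left 2 rfl) (ZMod n) k
    | .xa k => -1 - (i + ZMod.castHom (Dvd.intro_left 2 rfl) (ZMod n) k)
  one_smul i := by
    change i + ZMod.castHom (Dvd.intro_left 2 rfl : n ∣ 2 * n) (ZMod n) 0 = i
    rw [map_zero, add_zero]
  mul_smul g g' i := by
    let c : ZMod (2 * n) →+* ZMod n := ZMod.castHom (Dvd.intro_left 2 rfl) (ZMod n)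
    have hn : c (n : ZMod (2 * n)) = 0 := by rw [map_natCast]; exact ZMod.natCast_self n
    rcases g with k | k <;> rcases g' with k' | k'
    · change i + c (k + k') = i + c k' + c k
      rw [map_add]; ring
    · change -1 - (i + c (k' - k)) = -1 - (i + c k') + c k
      rw [map_sub]; ring
    · change -1 - (i + c (k + k')) = -1 - (i + c k' + c k)
      rw [map_add]; ring
    · change i + c (n + k' - k) = -1 - (-1 - (i + c k') + c k)
      rw [map_sub, map_add, hn]; ring

/-- The induced linear action of `Q₄ₙ` on `W_n`. -/
instance (n : ℕ) [NeZero n] : MulAction (QuaternionGroup n) (W n) where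
  smul g x := ⟨fun i => x.1 (g⁻¹ • i), by
    have h := x.2
    simp only [LinearMap.mem_ker, LinearMap.sum_apply, LinearMap.proj_apply] at h ⊢
    rw [← h]
    exact Equiv.sum_comp (MulAction.toPerm g⁻¹) x.1⟩
  one_smul x := by
    apply Subtype.ext; funext i
    change x.1 ((1 : QuaternionGroup n)⁻¹ • i) = x.1 i
    rw [inv_one, one_smul]
  mul_smul g g' x := by
    apply Subtype.ext; funext i
    change x.1 ((g * g')⁻¹ • i) = x.1 (g'⁻¹ • g⁻¹ • i)
    rw [mul_inv_rev, mul_smul]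

instance (n : ℕ) [NeZero n] : ContinuousConstSMul (QuaternionGroup n) (W n) where
  continuous_const_smul g := by
    refine Continuous.subtype_mk (f := fun (x : W n) (i : ZMod n) => x.1 (g⁻¹ • i)) ?_ _
    exact continuous_pi fun i => (continuous_apply (g⁻¹ • i)).comp continuous_subtype_val

/-- The subspace `L(α) ⊆ W_n` for `α = (a₁/n, a₂/n, a₃/n)`. -/
def L (n a₁ a₂ a₃ : ℕ) [NeZero n] : Set (W n) :=
  {x | ∑ i : ZMod n with i.val < a₁, x.1 i = 0 ∧
    ∑ i : ZMod n with a₁ ≤ i.val ∧ i.val < a₁ + a₂, x.1 i = 0 ∧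
    ∑ i : ZMod n with a₁ + a₂ ≤ i.val ∧ i.val < a₁ + a₂ + a₃, x.1 i = 0}

/-- Members of a hyper arrangement: linear hyperplanes of `W_n` and closed halves of them. -/
def IsHyperplaneOrHalf {n : ℕ} [NeZero n] (J : Set (W n)) : Prop :=
  ∃ l : W n →ₗ[ℝ] ℝ, l ≠ 0 ∧
    (J = {x | l x = 0} ∨ ∃ m : W n →ₗ[ℝ] ℝ, J = {x | l x = 0 ∧ 0 ≤ m x})

/-- The minimal `Q₄ₙ`-invariant arrangement containing `J ∩ L(α)` for `J ∈ 𝒥`. -/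
def arrangement {n : ℕ} [NeZero n] (a₁ a₂ a₃ : ℕ) (𝒥 : Set (Set (W n))) : Set (Set (W n)) :=
  {A | ∃ (g : QuaternionGroup n), ∃ J ∈ 𝒥, A = (g • ·) '' (J ∩ L n a₁ a₂ a₃)}

/-- The union `U*` of the arrangement. -/
def arrangementUnion {n : ℕ} [NeZero n] (a₁ a₂ a₃ : ℕ) (𝒥 : Set (Set (W n))) : Set (W n) :=
  ⋃₀ arrangement a₁ a₂ a₃ 𝒥

theorem smul_mem_arrangementUnion {n : ℕ} [NeZero n] {a₁ a₂ a₃ : ℕ} {𝒥 : Set (Set (W n))}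
    (g : QuaternionGroup n) {x : W n} (hx : x ∈ arrangementUnion a₁ a₂ a₃ 𝒥) :
    g • x ∈ arrangementUnion a₁ a₂ a₃ 𝒥 := by
  obtain ⟨_, ⟨g', J, hJ, rfl⟩, y, hy, rfl⟩ := hx
  exact ⟨_, ⟨g * g', J, hJ, rfl⟩, y, hy, mul_smul g g' y⟩

/-- The complement `T* = W_n ∖ U*`. -/
def Complement {n : ℕ} [NeZero n] (a₁ a₂ a₃ : ℕ) (𝒥 : Set (Set (W n))) : Type :=
  {x : W n // x ∉ arrangementUnion a₁ a₂ a₃ 𝒥}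

instance {n : ℕ} [NeZero n] (a₁ a₂ a₃ : ℕ) (𝒥 : Set (Set (W n))) :
    TopologicalSpace (Complement a₁ a₂ a₃ 𝒥) := instTopologicalSpaceSubtype

instance {n : ℕ} [NeZero n] (a₁ a₂ a₃ : ℕ) (𝒥 : Set (Set (W n))) :
    MulAction (QuaternionGroup n) (Complement a₁ a₂ a₃ 𝒥) where
  smul g x := ⟨g • x.1, fun h => x.2 (by
    have := smul_mem_arrangementUnion g⁻¹ h
    rwa [inv_smul_smul] at this)⟩
  one_smul x := Subtype.ext (one_smul _ x.1)
  mul_smul g g' x := Subtype.ext (mul_smul g g' x.1)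

instance {n : ℕ} [NeZero n] (a₁ a₂ a₃ : ℕ) (𝒥 : Set (Set (W n))) :
    ContinuousConstSMul (QuaternionGroup n) (Complement a₁ a₂ a₃ 𝒥) where
  continuous_const_smul g :=
    Continuous.subtype_mk ((continuous_const_smul g).comp continuous_subtype_val) _

/-! ### Maps in general position and their obstruction cocycles -/

/-- `h : S³ → W_n` is simplicial: affine on every simplex. -/
def IsSimplicial {n : ℕ} [NeZero n] (h : JoinSphere n → W n) : Prop :=
  ∀ x : JoinSphere n, h x = ∑ v, x.1 v • h (JoinSphere.vertex v)

/-- `h` commutes with the actions of `Q₄ₙ`. -/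
def IsEquivariant {n : ℕ} [NeZero n] (h : JoinSphere n → W n) : Prop :=
  ∀ (g : QuaternionGroup n) (x : JoinSphere n), h (g • x) = g • h x

/-- General position with respect to `U`: the image of a simplex meets `U` only if it is
3-dimensional, and then in finitely many points of its (relative) interior. -/
def InGeneralPosition {n : ℕ} [NeZero n] (U : Set (W n)) (h : JoinSphere n → W n) : Prop :=
  ∀ s ∈ joinComplex n, (h '' JoinSphere.closedSimplex s ∩ U).Nonempty →
    Module.finrank ℝ (vectorSpan ℝ (h '' JoinSphere.closedSimplex s)) = 3 ∧
    (h '' JoinSphere.closedSimplex s ∩ U).Finite ∧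
    h '' JoinSphere.closedSimplex s ∩ U ⊆ intrinsicInterior ℝ (h '' JoinSphere.closedSimplex s)

theorem IsSimplicial.continuous {n : ℕ} [NeZero n] {h : JoinSphere n → W n}
    (hs : IsSimplicial h) : Continuous h := by
  rw [show h = fun x : JoinSphere n => ∑ v, x.1 v • h (JoinSphere.vertex v) from funext hs]
  refine continuous_finsetSum _ fun v _ => ?_
  refine Continuous.smul (f := fun x : JoinSphere n => x.1 v) ?_ continuous_const
  exact (continuous_apply v).comp (continuous_subtype_val.comp continuous_subtype_val)

theorem InGeneralPosition.boundary_not_mem {n : ℕ} [NeZero n] {U : Set (W n)}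
    {h : JoinSphere n → W n} (hs : IsSimplicial h) (hg : InGeneralPosition U h)
    (σ : OrientedSimplex (joinComplex n) 3) (x : BdTetra) :
    h (JoinSphere.boundaryMap σ x) ∉ U := by
  intro hU
  obtain ⟨i, hi⟩ := x.2
  let s := Finset.univ.image (σ.face i).vertex
  have hx : JoinSphere.boundaryMap σ x ∈ JoinSphere.closedSimplex s := by
    intro v hv
    obtain ⟨j, hj, rfl⟩ := map_support _ _ _ hv
    have hji : j ≠ i := fun e => hj (e ▸ hi)
    obtain ⟨j', rfl⟩ := Fin.exists_succAbove_eq hji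
    exact Finset.mem_image_of_mem (σ.face i).vertex (Finset.mem_univ j')
  obtain ⟨hd, -, -⟩ := hg s (σ.face i).mem ⟨_, ⟨_, hx, rfl⟩, hU⟩
  let p : JoinVertex n → W n := fun v => h (JoinSphere.vertex v)
  have hsub : h '' JoinSphere.closedSimplex s ⊆ affineSpan ℝ (p '' s) := by
    rintro _ ⟨y, hy, rfl⟩
    rw [hs y]
    refine convexHull_subset_affineSpan _ ?_
    have hzero : ∀ v, v ∉ s → y.1 v = 0 := fun v hv => by_contra fun h0 => hv (hy v h0)
    rw [← Finset.sum_subset (Finset.subset_univ s) (fun v _ hv => by rw [hzero v hv, zero_smul])]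
    refine (convex_convexHull ℝ _).sum_mem (fun v _ => stdSimplex.zero_le y.1 v) ?_
      (fun v hv => subset_convexHull ℝ _ ⟨v, hv, rfl⟩)
    rw [Finset.sum_subset (Finset.subset_univ s) (fun v _ hv => hzero v hv)]
    exact stdSimplex.sum_eq_one y.1
  have hle : vectorSpan ℝ (h '' JoinSphere.closedSimplex s) ≤ vectorSpan ℝ (p '' s) := by
    rw [← direction_affineSpan, ← direction_affineSpan]
    exact AffineSubspace.direction_le (affineSpan_le.2 hsub)
  have hcard : s.card = 2 + 1 := by
    rw [Finset.card_image_of_injective _ (σ.face i).injective]; simp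
  have h2 : Module.finrank ℝ (vectorSpan ℝ (p '' s)) ≤ 2 := by
    have := finrank_vectorSpan_image_finset_le ℝ p s hcard
    rwa [Finset.coe_image] at this
  have := Submodule.finrank_mono hle
  omega

/-- The map `h|_{∂σ} : ∂σ → T*`, precomposed with the parametrization `∂Δ³ → ∂σ`. -/
def boundaryToComplement {n : ℕ} [NeZero n] {a₁ a₂ a₃ : ℕ} {𝒥 : Set (Set (W n))}
    {h : JoinSphere n → W n} (hs : IsSimplicial h)
    (hg : InGeneralPosition (arrangementUnion a₁ a₂ a₃ 𝒥) h)
    (σ : OrientedSimplex (joinComplex n) 3) : C(BdTetra, Complement a₁ a₂ a₃ 𝒥) where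
  toFun x := ⟨h (JoinSphere.boundaryMap σ x), hg.boundary_not_mem hs σ x⟩
  continuous_toFun :=
    Continuous.subtype_mk (hs.continuous.comp (JoinSphere.boundaryMap σ).continuous) _

theorem boundaryToComplement_reorder {n : ℕ} [NeZero n] {a₁ a₂ a₃ : ℕ} {𝒥 : Set (Set (W n))}
    {h : JoinSphere n → W n} (hs : IsSimplicial h)
    (hg : InGeneralPosition (arrangementUnion a₁ a₂ a₃ 𝒥) h)
    (σ : OrientedSimplex (joinComplex n) 3) (π : Equiv.Perm (Fin 4)) :
    boundaryToComplement hs hg (σ.reorder π) =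
      (boundaryToComplement hs hg σ).comp (BdTetra.permMap π) := by
  apply ContinuousMap.ext
  intro x
  have e : JoinSphere.boundaryMap (σ.reorder π) x =
      JoinSphere.boundaryMap σ (BdTetra.permMap π x) :=
    Subtype.ext (stdSimplex.map_comp_apply π σ.vertex x.1).symm
  exact Subtype.ext (congrArg h e)

theorem boundaryToComplement_smul {n : ℕ} [NeZero n] {a₁ a₂ a₃ : ℕ} {𝒥 : Set (Set (W n))}
    {h : JoinSphere n → W n} (hs : IsSimplicial h) (he : IsEquivariant h)
    (hg : InGeneralPosition (arrangementUnion a₁ a₂ a₃ 𝒥) h) (g : QuaternionGroup n)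
    (σ τ : OrientedSimplex (joinComplex n) 3) (hστ : ∀ i, τ.vertex i = g • σ.vertex i) :
    boundaryToComplement hs hg τ =
      (⟨fun y => g • y, continuous_const_smul g⟩ : C(Complement a₁ a₂ a₃ 𝒥, _)).comp
        (boundaryToComplement hs hg σ) := by
  apply ContinuousMap.ext
  intro x
  have e : JoinSphere.boundaryMap τ x = g • JoinSphere.boundaryMap σ x := by
    apply Subtype.ext
    change stdSimplex.map τ.vertex x.1 = stdSimplex.map (g • ·) (stdSimplex.map σ.vertex x.1)
    rw [stdSimplex.map_comp_apply]
    exact congrArg (fun f => stdSimplex.map f x.1) (funext hστ)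
  exact Subtype.ext ((congrArg h e).trans (he g _))

/-- The obstruction cochain `c(h) ∈ C³(S³; H₂(T*; ℤ))`, `c(h)(σ) = h_*[∂σ]`. -/
def obstructionCochain {n : ℕ} [NeZero n] {a₁ a₂ a₃ : ℕ} {𝒥 : Set (Set (W n))}
    {h : JoinSphere n → W n} (hs : IsSimplicial h) (he : IsEquivariant h)
    (hg : InGeneralPosition (arrangementUnion a₁ a₂ a₃ 𝒥) h) :
    EquivariantCochain (QuaternionGroup n) (joinComplex n) (H2 (Complement a₁ a₂ a₃ 𝒥)) 3 :=
  ⟨fun σ => H2.map (boundaryToComplement hs hg σ) BdTetra.fundamentalClass, by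
    refine ⟨fun σ π => ?_, fun g σ τ hστ => ?_⟩
    · beta_reduce
      rw [boundaryToComplement_reorder, H2.map_comp_apply, BdTetra.map_permMap_fundamentalClass,
        map_zsmul]
    · beta_reduce
      rw [boundaryToComplement_smul hs he hg g σ τ hστ, H2.map_comp_apply, H2.smul_def]⟩

theorem isEmpty_orientedSimplex_four (n : ℕ) : IsEmpty (OrientedSimplex (joinComplex n) 4) := by
  refine ⟨fun σ => ?_⟩
  obtain ⟨-, i, k, h⟩ := σ.mem
  have h1 := Finset.card_le_card h
  rw [Finset.card_image_of_injective _ σ.injective, Finset.card_univ, Fintype.card_fin] at h1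
  have := h1.trans Finset.card_le_four
  omega

/-- The obstruction cocycle `c(h)`; it is a cocycle since `S³` has no 4-simplices. -/
def obstructionCocycle {n : ℕ} [NeZero n] {a₁ a₂ a₃ : ℕ} {𝒥 : Set (Set (W n))}
    {h : JoinSphere n → W n} (hs : IsSimplicial h) (he : IsEquivariant h)
    (hg : InGeneralPosition (arrangementUnion a₁ a₂ a₃ 𝒥) h) :
    (coboundary (QuaternionGroup n) (joinComplex n) (H2 (Complement a₁ a₂ a₃ 𝒥)) 3).ker :=
  ⟨obstructionCochain hs he hg, by
    rw [AddMonoidHom.mem_ker]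
    apply Subtype.ext
    funext σ
    exact (isEmpty_orientedSimplex_four n).elim σ⟩

/-- The cohomology class `[c(h)] ∈ H³(S³; H₂(T*; ℤ))` of the obstruction cocycle. -/
def obstructionClass {n : ℕ} [NeZero n] {a₁ a₂ a₃ : ℕ} {𝒥 : Set (Set (W n))}
    {h : JoinSphere n → W n} (hs : IsSimplicial h) (he : IsEquivariant h)
    (hg : InGeneralPosition (arrangementUnion a₁ a₂ a₃ 𝒥) h) :
    EquivariantCohomology (QuaternionGroup n) (joinComplex n) (H2 (Complement a₁ a₂ a₃ 𝒥)) 2 :=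
  QuotientAddGroup.mk (obstructionCocycle hs he hg)

end FanObstruction
end

/-! The idea is transfer: forgetting the group, the obstruction cocycle is a coboundary, and
averaging over the finite group $\mathbb{Q}_{4n}$ turns this into an equivariant statement at the
cost of the factor $|\mathbb{Q}_{4n}| = 4n$.

General position puts the image of the 2-skeleton inside $T^*$, because a simplex of dimension at
most 2 cannot have a 3-dimensional image (`InGeneralPosition.param_not_mem`). Hence $h$ carries
simplicial 2-cycles to singular 2-cycles of $T^*$ and gives a homomorphism $\varphi : Z_2 \to
H_2(T^*)$ with $c(h)(\sigma) = \varphi(\partial\sigma)$ (`exists_hom_cycles`). Since $C_2/Z_2$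
embeds in the free group $C_1$, the subgroup $Z_2$ is a direct summand of $C_2$, so $\varphi$
extends to $\psi : C_2 \to H_2(T^*)$ (`exists_extend_of_ker`). Then $c(h) = \delta\psi$, though
$\psi$ need not be equivariant. The average $\sum_g g\,\psi(g^{-1}\,\cdot)$ is equivariant and has
coboundary $|G|\,c(h)$, because $c(h)$ is itself equivariant (`card_smul_mem_range_coboundary`).

The chains used here are free on ordered simplices with distinct vertices, without the relation
$\sigma\circ\pi = \operatorname{sign}(\pi)\,\sigma$: the singular simplices attached to two
orderings of one simplex differ as chains, so the relation would fail before passing to homology.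
The price is that $\psi$ need not be alternating. It is made so by evaluating it on increasingly
ordered simplices only, which keeps its coboundary because that coboundary is alternating
(`faceSum_alternate`). -/

noncomputable section
namespace FanObstruction
open CategoryTheory AlgebraicTopology
open scoped Simplicial

/-! ### Extending homomorphisms from kernels -/

/-- A homomorphism defined on the kernel of a linear map to a finite torsion-free module over a
principal ideal domain extends to the whole source. -/
theorem exists_extend_of_ker {R A B M : Type*} [CommRing R] [IsDomain R] [IsPrincipalIdealRing R]
    [AddCommGroup A] [Module R A] [AddCommGroup B] [Module R B] [Module.Finite R B]
    [Module.IsTorsionFree R B] [AddCommGroup M] [Module R M] (f : A →ₗ[R] B)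
    (φ : LinearMap.ker f →ₗ[R] M) :
    ∃ ψ : A →ₗ[R] M, ∀ z : LinearMap.ker f, ψ z = φ z := by
  -- The range is finite and torsion-free over a principal ideal domain, hence free and projective,
  -- so `f` has a section `s` over its range.
  obtain ⟨s, hs⟩ := Module.projective_lifting_property f.rangeRestrict
    (LinearMap.id : LinearMap.range f →ₗ[R] LinearMap.range f) f.surjective_rangeRestrict
  have hfs : ∀ y : LinearMap.range f, f (s y) = y := fun y =>
    congrArg Subtype.val (LinearMap.congr_fun hs y)
  -- The map $a \mapsto a - s(f(a))$ retracts `A` onto the kernel; composing `φ` with it gives the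
  -- extension.
  let r : A →ₗ[R] LinearMap.ker f :=
    (LinearMap.id - s ∘ₗ f.rangeRestrict).codRestrict (LinearMap.ker f) fun a => by
      simp [LinearMap.mem_ker, hfs]
  refine ⟨φ ∘ₗ r, fun z => ?_⟩
  have hz : f.rangeRestrict z = 0 := Subtype.ext z.2
  have hr : r z = z := Subtype.ext (by simp [r, hz])
  rw [LinearMap.comp_apply, hr]

/-! ### Ordered simplicial chains -/

section Chains

variable {V : Type} [DecidableEq V] {K : AbstractSimplicialComplex V}

theorem OrientedSimplex.vertex_injective {k : ℕ} :
    Function.Injective (OrientedSimplex.vertex : OrientedSimplex K k → Fin (k + 1) → V) :=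
  fun _ _ => OrientedSimplex.ext

/-- Makes the group of 1-chains finitely generated, as `exists_extend_of_ker` asks of the target. -/
instance [Finite V] (k : ℕ) : Finite (OrientedSimplex K k) :=
  Finite.of_injective _ OrientedSimplex.vertex_injective

/-- An iterated face depends only on the composite of the two coface maps, so each simplicial
identity becomes an equation between finite functions that `decide` settles. -/
theorem OrientedSimplex.face_face {k : ℕ} (σ : OrientedSimplex K (k + 2)) {i j : Fin (k + 3)}
    {p q : Fin (k + 2)} (h : i.succAbove ∘ p.succAbove = j.succAbove ∘ q.succAbove) :
    (σ.face i).face p = (σ.face j).face q := by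
  apply OrientedSimplex.ext
  change (σ.vertex ∘ i.succAbove) ∘ p.succAbove = (σ.vertex ∘ j.succAbove) ∘ q.succAbove
  rw [Function.comp_assoc, h, Function.comp_assoc]

/-- The alternating sum of the faces of an ordered simplex. -/
def OrientedSimplex.boundary {k : ℕ} (σ : OrientedSimplex K (k + 1)) : OrientedSimplex K k →₀ ℤ :=
  ∑ i : Fin (k + 2), (-1 : ℤ) ^ (i : ℕ) • Finsupp.single (σ.face i) 1

variable (K) in
/-- The boundary operator on the free abelian groups generated by the ordered simplices. -/
def chainBoundary (k : ℕ) : (OrientedSimplex K (k + 1) →₀ ℤ) →ₗ[ℤ] (OrientedSimplex K k →₀ ℤ) :=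
  Finsupp.linearCombination ℤ OrientedSimplex.boundary

theorem chainBoundary_single {k : ℕ} (σ : OrientedSimplex K (k + 1)) :
    chainBoundary K k (Finsupp.single σ 1) = σ.boundary := by
  simp [chainBoundary]

theorem OrientedSimplex.boundary_two (σ : OrientedSimplex K 2) :
    σ.boundary = Finsupp.single (σ.face 0) 1 - Finsupp.single (σ.face 1) 1 +
      Finsupp.single (σ.face 2) 1 := by
  refine (Fin.sum_univ_three _).trans ?_
  norm_num
  abel

theorem OrientedSimplex.boundary_three (σ : OrientedSimplex K 3) :
    σ.boundary = Finsupp.single (σ.face 0) 1 - Finsupp.single (σ.face 1) 1 +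
      Finsupp.single (σ.face 2) 1 - Finsupp.single (σ.face 3) 1 := by
  refine (Fin.sum_univ_four _).trans ?_
  norm_num
  abel

theorem chainBoundary_boundary (σ : OrientedSimplex K 3) :
    chainBoundary K 1 σ.boundary = 0 := by
  rw [OrientedSimplex.boundary_three]
  simp only [map_add, map_sub, chainBoundary_single, OrientedSimplex.boundary_two]
  -- The twelve edges in the double boundary coincide in six pairs of opposite sign.
  rw [σ.face_face (i := 1) (j := 0) (p := 0) (q := 0) (by decide),
    σ.face_face (i := 2) (j := 0) (p := 0) (q := 1) (by decide),
    σ.face_face (i := 3) (j := 0) (p := 0) (q := 2) (by decide),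
    σ.face_face (i := 2) (j := 1) (p := 1) (q := 1) (by decide),
    σ.face_face (i := 3) (j := 1) (p := 1) (q := 2) (by decide),
    σ.face_face (i := 3) (j := 2) (p := 2) (q := 2) (by decide)]
  abel

/-! ### From ordered cochains to equivariant alternating cochains -/

/-- Evaluate an ordered cochain on the increasing reordering of a simplex, with the sign of the
reordering. -/
def alternate {M : Type} [AddCommGroup M] (key : V → ℕ) {k : ℕ} (f : OrientedSimplex K k → M)
    (σ : OrientedSimplex K k) : M :=
  (Equiv.Perm.sign (Tuple.sort (key ∘ σ.vertex)) : ℤ) •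
    f (σ.reorder (Tuple.sort (key ∘ σ.vertex)))

/-- With an injective key the vertices have only one increasing order, so sorting after a reordering
leads to the same ordered simplex as sorting directly. -/
theorem mul_sort_reorder {key : V → ℕ} (hkey : Function.Injective key) {k : ℕ}
    (σ : OrientedSimplex K k) (π : Equiv.Perm (Fin (k + 1))) :
    π * Tuple.sort (key ∘ (σ.reorder π).vertex) = Tuple.sort (key ∘ σ.vertex) := by
  have h := Tuple.comp_perm_comp_sort_eq_comp_sort (f := key ∘ σ.vertex) (σ := π)
  exact Equiv.ext fun i => (hkey.comp σ.injective) (congrFun h i)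

/-- Both sides evaluate `f` at the same sorted simplex; only the sign of the sorting permutation
changes, by the factor `sign π`. -/
theorem alternate_reorder {M : Type} [AddCommGroup M] {key : V → ℕ}
    (hkey : Function.Injective key) {k : ℕ} (f : OrientedSimplex K k → M)
    (σ : OrientedSimplex K k) (π : Equiv.Perm (Fin (k + 1))) :
    alternate key f (σ.reorder π) = (Equiv.Perm.sign π : ℤ) • alternate key f σ := by
  have h := mul_sort_reorder hkey σ π
  have hr : (σ.reorder π).reorder (Tuple.sort (key ∘ (σ.reorder π).vertex)) =
      σ.reorder (Tuple.sort (key ∘ σ.vertex)) := by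
    rw [← h]
    rfl
  unfold alternate
  rw [hr, smul_smul, ← h, Equiv.Perm.sign_mul, Units.val_mul, ← mul_assoc,
    ← Units.val_mul, Int.units_mul_self, Units.val_one, one_mul]

theorem alternate_of_monotone {M : Type} [AddCommGroup M] {key : V → ℕ} {k : ℕ}
    (f : OrientedSimplex K k → M) {σ : OrientedSimplex K k} (hσ : Monotone (key ∘ σ.vertex)) :
    alternate key f σ = f σ := by
  unfold alternate
  rw [Tuple.sort_eq_refl_iff_monotone.2 hσ]
  simp [OrientedSimplex.reorder]

/-- The alternating sum of a function over the faces of an ordered simplex. -/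
def faceSum {M : Type} [AddCommGroup M] {k : ℕ} (f : OrientedSimplex K k → M)
    (σ : OrientedSimplex K (k + 1)) : M :=
  ∑ i : Fin (k + 2), (-1 : ℤ) ^ (i : ℕ) • f (σ.face i)

/-- The alternation argument from `coboundary`, freed from equivariance: it is applied to `alternate
key f`, which is alternating but need not be equivariant. -/
theorem faceSum_reorder {M : Type} [AddCommGroup M] {k : ℕ} {f : OrientedSimplex K k → M}
    (hf : ∀ σ π, f (σ.reorder π) = (Equiv.Perm.sign π : ℤ) • f σ)
    (σ : OrientedSimplex K (k + 1)) (π : Equiv.Perm (Fin (k + 2))) :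
    faceSum f (σ.reorder π) = (Equiv.Perm.sign π : ℤ) • faceSum f σ := by
  unfold faceSum
  rw [Finset.smul_sum, ← Equiv.sum_comp π fun i => _ • _ • f (σ.face i)]
  refine Finset.sum_congr rfl fun i _ => ?_
  obtain ⟨ρ, hρ, hs⟩ := exists_perm_succAbove π i
  have hface : (σ.reorder π).face i = (σ.face (π i)).reorder ρ :=
    OrientedSimplex.ext (funext fun j => congrArg σ.vertex (hρ j))
  rw [hface, hf, hs, smul_smul, smul_smul]
  congr 1
  have h1 : ((-1 : ℤ) ^ (i : ℕ)) * (-1) ^ (i : ℕ) = 1 := by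
    rw [← mul_pow]; simp
  linear_combination ((-1 : ℤ) ^ (π i : ℕ) * (Equiv.Perm.sign π : ℤ)) * h1

/-- If the coboundary of an ordered cochain is alternating, then it is also the coboundary of an
alternating cochain. -/
theorem faceSum_alternate {M : Type} [AddCommGroup M] {key : V → ℕ}
    (hkey : Function.Injective key) {k : ℕ} {f : OrientedSimplex K k → M}
    (hf : ∀ σ π, faceSum f (σ.reorder π) = (Equiv.Perm.sign π : ℤ) • faceSum f σ)
    (σ : OrientedSimplex K (k + 1)) :
    faceSum (alternate key f) σ = faceSum f σ := by
  -- Faces of an increasing simplex are increasing, so the two cochains agree on all faces of the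
  -- sorted simplex. Both coboundaries are alternating, which carries the equality back to `σ`.
  let π := Tuple.sort (key ∘ σ.vertex)
  have hmono : Monotone (key ∘ (σ.reorder π).vertex) := Tuple.monotone_sort (key ∘ σ.vertex)
  have h : faceSum (alternate key f) (σ.reorder π) = faceSum f (σ.reorder π) :=
    Finset.sum_congr rfl fun i _ => by
      rw [alternate_of_monotone f (hmono.comp (Fin.strictMono_succAbove i).monotone)]
  rw [faceSum_reorder (alternate_reorder hkey f), hf] at h
  have h' := congrArg ((Equiv.Perm.sign π : ℤ) • ·) h
  simpa only [smul_smul, ← Units.val_mul, Int.units_mul_self, Units.val_one, one_smul] using h'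

variable {G : Type} [Group G] [MulAction G V]

/-- The image of an ordered simplex under a simplicial automorphism of the group. -/
def OrientedSimplex.translate (hK : ∀ (g : G), ∀ s ∈ K, s.image (g • ·) ∈ K) {k : ℕ} (g : G)
    (σ : OrientedSimplex K k) : OrientedSimplex K k where
  vertex i := g • σ.vertex i
  injective := (MulAction.injective g).comp σ.injective
  mem := by
    have h := hK g _ σ.mem
    rwa [Finset.image_image] at h

/-- An equivariant alternating cochain which is the coboundary of a cochain that need not be
equivariant or alternating becomes the coboundary of an equivariant alternating cochain after
multiplication by the order of the group. -/
theorem card_smul_mem_range_coboundary [Fintype G] [Finite V]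
    (hK : ∀ (g : G), ∀ s ∈ K, s.image (g • ·) ∈ K) {M : Type} [AddCommGroup M]
    [DistribMulAction G M] {k : ℕ} (c : EquivariantCochain G K M (k + 1))
    (f : OrientedSimplex K k → M) (hf : ∀ σ, faceSum f σ = c.1 σ) :
    Fintype.card G • c ∈ (coboundary G K M k).range := by
  -- Any numbering of the vertices will do. It need not respect the group action, since averaging
  -- restores equivariance afterwards.
  obtain ⟨N, ⟨e⟩⟩ := Finite.exists_equiv_fin V
  let key : V → ℕ := fun v => e v
  have hkey : Function.Injective key := Fin.val_injective.comp e.injective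
  have hψ : ∀ σ, faceSum (alternate key f) σ = c.1 σ := fun σ => by
    rw [faceSum_alternate hkey (fun σ π => by rw [hf, hf, c.2.1]), hf]
  refine ⟨⟨fun σ => ∑ g : G, g • alternate key f (σ.translate hK g⁻¹), ?_, ?_⟩, ?_⟩
  · intro σ π
    rw [Finset.smul_sum]
    refine Finset.sum_congr rfl fun g _ => ?_
    rw [← smul_comm g, ← alternate_reorder hkey]
    rfl
  · intro g σ τ h
    beta_reduce
    -- Left translation of the summation index by `g` matches the two averages term by term.
    rw [Finset.smul_sum, ← Equiv.sum_comp (Equiv.mulLeft g)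
      fun g' => g' • alternate key f (τ.translate hK g'⁻¹)]
    refine Finset.sum_congr rfl fun g' _ => ?_
    have e : τ.translate hK (g * g')⁻¹ = σ.translate hK g'⁻¹ :=
      OrientedSimplex.ext (funext fun i => by
        change (g * g')⁻¹ • τ.vertex i = g'⁻¹ • σ.vertex i
        rw [h, mul_inv_rev, mul_smul, inv_smul_smul])
    rw [Equiv.coe_mulLeft, e, mul_smul]
  · apply Subtype.ext
    funext σ
    change ∑ i : Fin (k + 2), (-1 : ℤ) ^ (i : ℕ) •
      ∑ g : G, g • alternate key f ((σ.face i).translate hK g⁻¹) = Fintype.card G • c.1 σ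
    simp only [Finset.smul_sum]
    rw [Finset.sum_comm]
    refine (Finset.sum_congr rfl fun g _ => ?_).trans (Finset.card_univ (α := G) ▸ Finset.sum_const _)
    -- Equivariance of `c` gives $g\,c(g^{-1}\sigma) = c(\sigma)$, so every group element
    -- contributes the same term.
    have h1 : g • faceSum (alternate key f) (σ.translate hK g⁻¹) = c.1 σ := by
      rw [hψ, ← c.2.2 g (σ.translate hK g⁻¹) σ fun i => (smul_inv_smul g (σ.vertex i)).symm]
    rw [← h1, faceSum, Finset.smul_sum]
    exact Finset.sum_congr rfl fun i _ => smul_comm _ _ _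

/-- If the value of an equivariant 3-cochain on a simplex is given by a homomorphism on the
2-cycles, evaluated at the boundary, then its multiple by the order of the group is a
coboundary. -/
theorem card_smul_mem_range_coboundary_of_cycles [Fintype G] [Finite V]
    (hK : ∀ (g : G), ∀ s ∈ K, s.image (g • ·) ∈ K) {M : Type} [AddCommGroup M]
    [DistribMulAction G M] (c : EquivariantCochain G K M 3)
    (φ : LinearMap.ker (chainBoundary K 1) →ₗ[ℤ] M)
    (hφ : ∀ σ : OrientedSimplex K 3, φ ⟨σ.boundary, chainBoundary_boundary σ⟩ = c.1 σ) :
    Fintype.card G • c ∈ (coboundary G K M 2).range := by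
  -- The extension is only ℤ-linear; its values on generators form an ordered cochain with
  -- coboundary `c`.
  obtain ⟨ψ, hψ⟩ := exists_extend_of_ker (chainBoundary K 1) φ
  refine card_smul_mem_range_coboundary hK c (fun σ => ψ (Finsupp.single σ 1)) fun σ => ?_
  rw [← hφ, ← hψ]
  simp only [faceSum, OrientedSimplex.boundary, map_sum, map_zsmul]

end Chains

/-! ### Singular cycles from simplicial cycles -/

section Singular

variable (X : Type) [TopologicalSpace X]

/-- The singular chain complex of a space. -/
abbrev singularChains : ChainComplex (ModuleCat.{0} ℤ) ℕ :=
  ((singularChainComplexFunctor (ModuleCat.{0} ℤ)).obj (ModuleCat.of ℤ ℤ)).obj (TopCat.of X)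

variable {X}

/-- A singular simplex, as a simplex of the singular simplicial set. -/
def singularSimplex {k : ℕ} (s : C(stdSimplex ℝ (Fin (k + 1)), X)) :
    (TopCat.toSSet.obj (TopCat.of X)) _⦋k⦌ :=
  (TopCat.toSSetObjEquiv (TopCat.of X) (.op ⦋k⦌)).symm s

/-- The generator of the singular chains given by a singular simplex. -/
def singularGen {k : ℕ} (s : C(stdSimplex ℝ (Fin (k + 1)), X)) :
    ModuleCat.of ℤ ℤ ⟶ (singularChains X).X k :=
  SSet.ιChainComplex (X := TopCat.toSSet.obj (TopCat.of X)) (R := ModuleCat.of ℤ ℤ)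
    (singularSimplex s)

/-- The `i`-th face of a singular simplex. -/
def singularFace {k : ℕ} (s : C(stdSimplex ℝ (Fin (k + 2)), X)) (i : Fin (k + 2)) :
    C(stdSimplex ℝ (Fin (k + 1)), X) :=
  s.comp ⟨stdSimplex.map i.succAbove, stdSimplex.continuous_map _⟩

theorem δ_singularSimplex {k : ℕ} (s : C(stdSimplex ℝ (Fin (k + 2)), X)) (i : Fin (k + 2)) :
    (TopCat.toSSet.obj (TopCat.of X)).δ i (singularSimplex s) =
      singularSimplex (singularFace s i) := by
  apply (TopCat.toSSetObjEquiv (TopCat.of X) (.op ⦋k⦌)).injective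
  unfold singularSimplex
  rw [Equiv.apply_symm_apply]
  rfl

theorem singularGen_d {k : ℕ} (s : C(stdSimplex ℝ (Fin (k + 2)), X)) :
    singularGen s ≫ (singularChains X).d (k + 1) k =
      ∑ i : Fin (k + 2), (-1 : ℤ) ^ (i : ℕ) • singularGen (singularFace s i) := by
  unfold singularGen
  refine (SSet.ιChainComplex_d (X := TopCat.toSSet.obj (TopCat.of X)) (R := ModuleCat.of ℤ ℤ)
    (singularSimplex s)).trans ?_
  refine Finset.sum_congr rfl fun i _ => ?_
  rw [δ_singularSimplex]
  rfl

/-- The chain map induced by a continuous map from `∂Δ³`. -/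
def BdTetra.chainMap (b : C(BdTetra, X)) : BdTetra.chains ⟶ singularChains X :=
  ((singularChainComplexFunctor (ModuleCat.{0} ℤ)).obj (ModuleCat.of ℤ ℤ)).map (TopCat.ofHom b)

theorem BdTetra.gen_map (b : C(BdTetra, X)) {k : ℕ} (v : Fin (k + 1) → Fin 4)
    (hv : ∃ i, ∀ j, v j ≠ i) :
    BdTetra.gen v hv ≫ (BdTetra.chainMap b).f k = singularGen (b.comp (BdTetra.simplex v hv)) := by
  refine (SSet.ι_chainComplexMap_f (X := TopCat.toSSet.obj (TopCat.of BdTetra))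
    (Y := TopCat.toSSet.obj (TopCat.of X)) (f := TopCat.toSSet.map
      (TopCat.ofHom b)) (R := ModuleCat.of ℤ ℤ) _).trans ?_
  unfold singularGen
  congr 1

/-- The class of a family of singular 2-cycles. -/
def cyclesToH2 {A : Type} [AddCommGroup A] (z : ModuleCat.of ℤ A ⟶ (singularChains X).X 2)
    (hz : z ≫ (singularChains X).d 2 1 = 0) : A →+ H2 X :=
  (HomologicalComplex.liftCycles (singularChains X) z 1 (by simp) hz ≫
    HomologicalComplex.homologyπ (singularChains X) 2).hom.toAddMonoidHom

/-- Equality of representing chains suffices, since cycles embed in chains and the projection to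
homology is natural. The element `x` enters as the morphism from ℤ sending 1 to `x`, to be
comparable with `BdTetra.cycle`. -/
theorem map_fundamentalClass_eq {A : Type} [AddCommGroup A]
    (z : ModuleCat.of ℤ A ⟶ (singularChains X).X 2)
    (hz : z ≫ (singularChains X).d 2 1 = 0) (b : C(BdTetra, X)) (x : A)
    (hx : ModuleCat.ofHom (LinearMap.toSpanSingleton ℤ A x) ≫ z =
      BdTetra.cycle id ≫ (BdTetra.chainMap b).f 2) :
    cyclesToH2 z hz x = H2.map b BdTetra.fundamentalClass := by
  have h : (HomologicalComplex.liftCycles BdTetra.chains (BdTetra.cycle id) 1 (by simp)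
      (BdTetra.cycle_d id) ≫ HomologicalComplex.homologyπ BdTetra.chains 2) ≫
        HomologicalComplex.homologyMap (BdTetra.chainMap b) 2 =
      ModuleCat.ofHom (LinearMap.toSpanSingleton ℤ A x) ≫
        HomologicalComplex.liftCycles (singularChains X) z 1 (by simp) hz ≫
          HomologicalComplex.homologyπ (singularChains X) 2 := by
    rw [Category.assoc, HomologicalComplex.homologyπ_naturality, ← Category.assoc,
      ← Category.assoc]
    congr 1
    rw [← cancel_mono (HomologicalComplex.iCycles _ _)]
    simp only [Category.assoc, HomologicalComplex.cyclesMap_i,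
      HomologicalComplex.liftCycles_i, HomologicalComplex.liftCycles_i_assoc]
    exact hx.symm
  have h1 := congrArg (fun f => f.hom (1 : ℤ)) h
  have h2 : (ModuleCat.ofHom (LinearMap.toSpanSingleton ℤ A x)).hom (1 : ℤ) = x := by simp
  exact ((congrArg (cyclesToH2 z hz) h2).symm.trans h1.symm :)

variable {V : Type} [DecidableEq V] {K : AbstractSimplicialComplex V}

/-- The homomorphism from simplicial to singular chains given by singular simplices indexed by the
ordered simplices. -/
def simplicialToSingular {k : ℕ} (s : OrientedSimplex K k → C(stdSimplex ℝ (Fin (k + 1)), X)) :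
    (OrientedSimplex K k →₀ ℤ) →ₗ[ℤ] (singularChains X).X k :=
  Finsupp.linearCombination ℤ fun σ => (singularGen (s σ)).hom (1 : ℤ)

theorem simplicialToSingular_single {k : ℕ}
    (s : OrientedSimplex K k → C(stdSimplex ℝ (Fin (k + 1)), X)) (σ : OrientedSimplex K k) :
    simplicialToSingular s (Finsupp.single σ 1) = (singularGen (s σ)).hom (1 : ℤ) := by
  rw [simplicialToSingular, Finsupp.linearCombination_single]
  exact ((singularGen (s σ)).hom.map_smul (1 : ℤ) (1 : ℤ)).symm

/-- On generators, `hst` makes this the chain map condition; it is what sends simplicial cycles to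
singular cycles. -/
theorem d_simplicialToSingular {k : ℕ}
    {s : OrientedSimplex K (k + 1) → C(stdSimplex ℝ (Fin (k + 2)), X)}
    {t : OrientedSimplex K k → C(stdSimplex ℝ (Fin (k + 1)), X)}
    (hst : ∀ σ i, singularFace (s σ) i = t (σ.face i)) (c : OrientedSimplex K (k + 1) →₀ ℤ) :
    ((singularChains X).d (k + 1) k).hom (simplicialToSingular s c) =
      simplicialToSingular t (chainBoundary K k c) := by
  have h : ((singularChains X).d (k + 1) k).hom ∘ₗ simplicialToSingular s =
      simplicialToSingular t ∘ₗ chainBoundary K k := by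
    refine Finsupp.lhom_ext' fun σ => LinearMap.ext_ring ?_
    change ((singularChains X).d (k + 1) k).hom (simplicialToSingular s (Finsupp.single σ 1)) =
      simplicialToSingular t (chainBoundary K k (Finsupp.single σ 1))
    rw [simplicialToSingular_single, chainBoundary_single, OrientedSimplex.boundary, map_sum]
    refine (congrArg (fun f => f.hom (1 : ℤ)) (singularGen_d (s σ))).trans ?_
    simp only [hst, map_zsmul, simplicialToSingular_single]
    simp
  exact LinearMap.congr_fun h c

/-- A compatible family of singular 2- and 1-simplices indexed by the ordered simplices of `K`
induces a homomorphism from the simplicial 2-cycles to `H₂(X)`. Its value on the boundary of a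
3-simplex is the image of the fundamental class of `∂Δ³`. -/
theorem exists_hom_cycles
    (s : OrientedSimplex K 2 → C(stdSimplex ℝ (Fin 3), X))
    (t : OrientedSimplex K 1 → C(stdSimplex ℝ (Fin 2), X))
    (hst : ∀ σ i, singularFace (s σ) i = t (σ.face i))
    (b : OrientedSimplex K 3 → C(BdTetra, X))
    (hb : ∀ σ i, (b σ).comp (BdTetra.simplex (k := 2) i.succAbove
      (exists_not_mem (by norm_num) _)) = s (σ.face i)) :
    ∃ φ : LinearMap.ker (chainBoundary K 1) →ₗ[ℤ] H2 X, ∀ σ : OrientedSimplex K 3,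
      φ ⟨σ.boundary, chainBoundary_boundary σ⟩ = H2.map (b σ) BdTetra.fundamentalClass := by
  let z : ModuleCat.of ℤ (LinearMap.ker (chainBoundary K 1)) ⟶ (singularChains X).X 2 :=
    ModuleCat.ofHom (simplicialToSingular s ∘ₗ (LinearMap.ker (chainBoundary K 1)).subtype)
  have hz : z ≫ (singularChains X).d 2 1 = 0 := by
    ext c
    refine (d_simplicialToSingular hst c.1).trans ?_
    rw [c.2, map_zero]
    rfl
  refine ⟨(cyclesToH2 z hz).toIntLinearMap, fun σ => map_fundamentalClass_eq z hz (b σ) _ ?_⟩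
  refine ModuleCat.hom_ext (LinearMap.ext_ring ?_)
  -- By `hb`, the fundamental cycle pushes forward to the image of `σ.boundary` already as a chain,
  -- so no homotopy is needed.
  have h1 : BdTetra.cycle id ≫ (BdTetra.chainMap (b σ)).f 2 =
      ∑ i : Fin 4, (-1 : ℤ) ^ (i : ℕ) • singularGen (s (σ.face i)) := by
    unfold BdTetra.cycle
    rw [Preadditive.sum_comp]
    refine Finset.sum_congr rfl fun i _ => ?_
    rw [Preadditive.zsmul_comp, BdTetra.gen_map, ← hb]
    rfl
  rw [h1]
  change simplicialToSingular s ((1 : ℤ) • σ.boundary) = _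
  rw [one_smul, OrientedSimplex.boundary, map_sum]
  simp only [map_zsmul, simplicialToSingular_single]
  simp

end Singular

/-! ### The obstruction class -/

section Obstruction

variable {n : ℕ} [NeZero n]

/-- The parametrization of a closed simplex of the join of two polygons. -/
def JoinSphere.param {k : ℕ} (σ : OrientedSimplex (joinComplex n) k) :
    C(stdSimplex ℝ (Fin (k + 1)), JoinSphere n) where
  toFun x := ⟨stdSimplex.map σ.vertex x, Finset.univ.image σ.vertex, σ.mem, fun v hv => by
    obtain ⟨i, -, rfl⟩ := map_support _ _ _ hv
    exact Finset.mem_image_of_mem _ (Finset.mem_univ i)⟩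
  continuous_toFun := Continuous.subtype_mk (stdSimplex.continuous_map _) _

theorem JoinSphere.param_mem {k : ℕ} (σ : OrientedSimplex (joinComplex n) k)
    (x : stdSimplex ℝ (Fin (k + 1))) :
    JoinSphere.param σ x ∈ JoinSphere.closedSimplex (Finset.univ.image σ.vertex) := by
  intro v hv
  obtain ⟨i, -, rfl⟩ := map_support _ _ _ hv
  exact Finset.mem_image_of_mem _ (Finset.mem_univ i)

/-- Supplies both compatibility hypotheses of `exists_hom_cycles`: triangles with their edges, and
the boundary of a 3-simplex with its triangles. -/
theorem JoinSphere.param_face {k : ℕ} (σ : OrientedSimplex (joinComplex n) (k + 1))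
    (i : Fin (k + 2)) (x : stdSimplex ℝ (Fin (k + 1))) :
    JoinSphere.param σ (stdSimplex.map i.succAbove x) = JoinSphere.param (σ.face i) x :=
  Subtype.ext (stdSimplex.map_comp_apply i.succAbove σ.vertex x)

/-- The image of a simplex under a simplicial map has at most the dimension of the simplex. -/
theorem IsSimplicial.finrank_vectorSpan_le {h : JoinSphere n → W n} (hs : IsSimplicial h)
    {s : Finset (JoinVertex n)} {k : ℕ} (hcard : s.card = k + 1) :
    Module.finrank ℝ (vectorSpan ℝ (h '' JoinSphere.closedSimplex s)) ≤ k := by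
  let p : JoinVertex n → W n := fun v => h (JoinSphere.vertex v)
  have hsub : h '' JoinSphere.closedSimplex s ⊆ affineSpan ℝ (p '' s) := by
    rintro _ ⟨y, hy, rfl⟩
    -- Coordinates outside `s` vanish, so `h y` is a convex combination of the images of the `k + 1`
    -- vertices of `s`.
    rw [hs y]
    refine convexHull_subset_affineSpan _ ?_
    have hzero : ∀ v, v ∉ s → y.1 v = 0 := fun v hv => by_contra fun h0 => hv (hy v h0)
    rw [← Finset.sum_subset (Finset.subset_univ s) (fun v _ hv => by rw [hzero v hv, zero_smul])]
    refine (convex_convexHull ℝ _).sum_mem (fun v _ => stdSimplex.zero_le y.1 v) ?_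
      (fun v hv => subset_convexHull ℝ _ ⟨v, hv, rfl⟩)
    rw [Finset.sum_subset (Finset.subset_univ s) (fun v _ hv => hzero v hv)]
    exact stdSimplex.sum_eq_one y.1
  have hle : vectorSpan ℝ (h '' JoinSphere.closedSimplex s) ≤ vectorSpan ℝ (p '' s) := by
    rw [← direction_affineSpan, ← direction_affineSpan]
    exact AffineSubspace.direction_le (affineSpan_le.2 hsub)
  have h2 : Module.finrank ℝ (vectorSpan ℝ (p '' s)) ≤ k := by
    have := finrank_vectorSpan_image_finset_le ℝ p s hcard
    rwa [Finset.coe_image] at this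
  exact (Submodule.finrank_mono hle).trans h2

/-- A map in general position sends the 2-skeleton into the complement of `U`. -/
theorem InGeneralPosition.param_not_mem {U : Set (W n)} {h : JoinSphere n → W n}
    (hs : IsSimplicial h) (hg : InGeneralPosition U h) {k : ℕ} (hk : k < 3)
    (σ : OrientedSimplex (joinComplex n) k) (x : stdSimplex ℝ (Fin (k + 1))) :
    h (JoinSphere.param σ x) ∉ U := by
  intro hU
  -- Meeting `U` would force an image of dimension 3, but `k + 1` vertices span dimension at most `k
  -- < 3`.
  obtain ⟨hd, -, -⟩ := hg _ σ.mem ⟨_, ⟨_, JoinSphere.param_mem σ x, rfl⟩, hU⟩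
  have hcard : (Finset.univ.image σ.vertex).card = k + 1 := by
    rw [Finset.card_image_of_injective _ σ.injective]; simp
  have := hs.finrank_vectorSpan_le hcard
  omega

variable {a₁ a₂ a₃ : ℕ} {𝒥 : Set (Set (W n))} {h : JoinSphere n → W n}

/-- The restriction of a map in general position to a simplex of the 2-skeleton. -/
def simplexToComplement (hs : IsSimplicial h)
    (hg : InGeneralPosition (arrangementUnion a₁ a₂ a₃ 𝒥) h) {k : ℕ} (hk : k < 3)
    (σ : OrientedSimplex (joinComplex n) k) :
    C(stdSimplex ℝ (Fin (k + 1)), Complement a₁ a₂ a₃ 𝒥) where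
  toFun x := ⟨h (JoinSphere.param σ x), hg.param_not_mem hs hk σ x⟩
  continuous_toFun :=
    Continuous.subtype_mk (hs.continuous.comp (JoinSphere.param σ).continuous) _

/-- The obstruction cocycle multiplied by the order of the group is a coboundary. -/
theorem card_smul_obstructionCochain_mem (hs : IsSimplicial h) (he : IsEquivariant h)
    (hg : InGeneralPosition (arrangementUnion a₁ a₂ a₃ 𝒥) h) :
    Fintype.card (QuaternionGroup n) • obstructionCochain hs he hg ∈
      (coboundary (QuaternionGroup n) (joinComplex n) (H2 (Complement a₁ a₂ a₃ 𝒥)) 2).range := by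
  -- The two families are the restrictions of `h` to triangles and to edges; `φ` sends a 2-cycle to
  -- the class of its image in $T^*$.
  obtain ⟨φ, hφ⟩ := exists_hom_cycles
    (simplexToComplement hs hg (by norm_num)) (simplexToComplement hs hg (by norm_num))
    (fun σ i => ContinuousMap.ext fun x =>
      Subtype.ext (congrArg h (JoinSphere.param_face σ i x)))
    (boundaryToComplement hs hg)
    (fun σ i => ContinuousMap.ext fun x =>
      Subtype.ext (congrArg h (JoinSphere.param_face σ i x)))
  exact card_smul_mem_range_coboundary_of_cycles (fun g _ => joinComplex_image_smul g) _ φ hφ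

/-- The order of the obstruction class divides the order of the group. -/
theorem card_smul_obstructionClass (hs : IsSimplicial h) (he : IsEquivariant h)
    (hg : InGeneralPosition (arrangementUnion a₁ a₂ a₃ 𝒥) h) :
    Fintype.card (QuaternionGroup n) • obstructionClass hs he hg = 0 := by
  refine (QuotientAddGroup.eq_zero_iff
    (Fintype.card (QuaternionGroup n) • obstructionCocycle hs he hg)).2 ?_
  exact card_smul_obstructionCochain_mem hs he hg

end Obstruction

end FanObstruction
end

theorem proposition8 (n a₁ a₂ a₃ : ℕ) [NeZero n]
    (h₁ : 0 < a₁) (h₂ : 0 < a₂) (h₃ : 0 < a₃) (hn : a₁ + a₂ + a₃ = n)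
    (𝒥 : Set (Set (FanObstruction.W n))) (h𝒥fin : 𝒥.Finite)
    (h𝒥 : ∀ J ∈ 𝒥, FanObstruction.IsHyperplaneOrHalf J)
    (h : FanObstruction.JoinSphere n → FanObstruction.W n)
    (hs : FanObstruction.IsSimplicial h) (he : FanObstruction.IsEquivariant h)
    (hg : FanObstruction.InGeneralPosition (FanObstruction.arrangementUnion a₁ a₂ a₃ 𝒥) h) :
    IsOfFinAddOrder (FanObstruction.obstructionClass hs he hg) := by
  -- The annihilating multiple is the order $4n$ of the group.
  exact isOfFinAddOrder_iff_nsmul_eq_zero.2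
    ⟨_, Fintype.card_pos, FanObstruction.card_smul_obstructionClass hs he hg⟩
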